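/- For $j\ge 1$ put $\lambda_j=(j\pi)^2$ and $\varphi_j(x)=\sqrt2\,\sin(j\pi x)$ on $(0,1)$, and write $\langle f,g\rangle=\int_0^1 f\,\bar g\,dx$. For all integers $n\ge 1$, $K\ge 2$ and $p,m\ge 0$ with $\lfloor n/2\rfloor\le p$, there exist real-valued functions $\mu_1,\mu_2$ on $(0,1)$ that satisfy all of the following, where, for $j\geq 1$, $$c_j=\langle\mu_1\varphi_1,\varphi_j\rangle\langle\mu_1\varphi_j,\varphi_K\rangle,\quad \tilde c_j=\langle\mu_2\varphi_1,\varphi_j\rangle\langle\mu_2\varphi_j,\varphi_K\rangle,\quad d_j=\langle\mu_2\varphi_1,\varphi_j\rangle\langle\mu_1\varphi_j,\varphi_K\rangle,\quad \tilde d_j=\langle\mu_1\varphi_1,\varphi_j\rangle\langle\mu_2\varphi_j,\varphi_K\rangle .$$ - $(H)_{reg}$: $\mu_1,\mu_2\in H^{2(p+m)+3}((0,1),\mathbb R)$ and $\mu_\ell^{(2k+1)}(0)=\mu_\ell^{(2k+1)}(1)=0$ for $\ell\in\{1,2\}$ and all integers $0\le k\le p-1$. - $(H)_{lin,K,1}$: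 $\langle\mu_1\varphi_1,\varphi_K\rangle=\langle\mu_2\varphi_1,\varphi_K\rangle=0$. - $(H)_{lin,K,2}$: there is $C>0$ such that for all integers $j\ge1$ with $j\ne K$, $\left(\langle\mu_1\varphi_1,\varphi_j\rangle^2+\langle\mu_2\varphi_1,\varphi_j\rangle^2\right)^{1/2}\ge C\,j^{-(2p+3)}$. - $(H)_{quad,K,1}$: for all integers $1\le k\le\lfloor\frac{n+1}2\rfloor$, $$A_k^1:=(-1)^{k-1}\sum_{j=1}^{\infty}\Big(\lambda_j-\frac{\lambda_1+\lambda_K}2\Big)(\lambda_K-\lambda_j)^{k-1}(\lambda_j-\lambda_1)^{k-1}c_j=0 .$$ - $(H)_{quad,K,2}$: for all integers $1\le k\le\lfloor\frac{n+1}2\rfloor$, $$A_k^2:=(-1)^{k-1}\sum_{j=1}^{\infty}\Big(\lambda_j-\frac{\lambda_1+\lambda_K}2\Big)(\lambda_K-\lambda_j)^{k-1}(\lambda_j-\lambda_1)^{k-1}\tilde c_j=0 .$$ - $(H)_{quad,K,3}$: for all integers $1\le k\le n-1$, $\gamma_k=0$, and $(H)_{quad,K,4}$: $\gamma_n\neq0$,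 where for $k\ge1$ $$\gamma_k:=\sum_{j=1}^{\infty}\Big((\lambda_K-\lambda_j)^{\lfloor\frac{k+1}2\rfloor}(\lambda_j-\lambda_1)^{\lfloor\frac k2\rfloor}d_j-(\lambda_K-\lambda_j)^{\lfloor\frac k2\rfloor}(\lambda_j-\lambda_1)^{\lfloor\frac{k+1}2\rfloor}\tilde d_j\Big).$$ All the series above converge absolutely. -/

import Mathlib

open scoped ContDiff

namespace BilinearSchrodinger

noncomputable section

/-! ### Sobolev spaces on the interval `(0,1)` -/

/-- `φ` is a test function on `(0,1)`: smooth, with compact support contained in `(0,1)`. -/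
def IsTestFunction (φ : ℝ → ℝ) : Prop :=
  ContDiff ℝ ∞ φ ∧ HasCompactSupport φ ∧ tsupport φ ⊆ Set.Ioo (0 : ℝ) 1

/-- `g` is the weak derivative of order `i` of `f` on `(0,1)`; only the values of `f` and `g` on
`(0,1)` matter. -/
def IsWeakDeriv (i : ℕ) (f g : ℝ → ℝ) : Prop :=
  ∀ φ : ℝ → ℝ, IsTestFunction φ →
    ∫ x in (0 : ℝ)..1, f x * iteratedDeriv i φ x = (-1) ^ i * ∫ x in (0 : ℝ)..1, g x * φ x

/-- Membership in `L²((0,1), ℝ)`. -/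
def MemL2 (f : ℝ → ℝ) : Prop :=
  MeasureTheory.MemLp f 2 (MeasureTheory.volume.restrict (Set.Ioo (0 : ℝ) 1))

/-- Membership in the Sobolev space `H^s((0,1), ℝ)`, for an integer `s`: `f` is in `L²`, and so are
its weak derivatives up to order `s`. -/
def MemH (s : ℕ) (f : ℝ → ℝ) : Prop :=
  MemL2 f ∧ ∀ i ≤ s, ∃ g : ℝ → ℝ, MemL2 g ∧ IsWeakDeriv i f g

/-- `f^{(i)}(0) = f^{(i)}(1) = 0`: the weak derivative of order `i` of `f` on `(0,1)` has a
representative that is continuous on `[0,1]`, and this (unique) continuous representative vanishes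
at both end points. -/
def DerivVanishesAtBoundary (i : ℕ) (f : ℝ → ℝ) : Prop :=
  ∃ g : ℝ → ℝ, ContinuousOn g (Set.Icc (0 : ℝ) 1) ∧ IsWeakDeriv i f g ∧ g 0 = 0 ∧ g 1 = 0

/-! ### The Dirichlet Laplacian on `(0,1)` -/

/-- The scalar product of `L²(0,1)`, for real-valued functions. -/
def ip (f g : ℝ → ℝ) : ℝ := ∫ x in (0 : ℝ)..1, f x * g x

/-- The eigenvalues `λ_j = (jπ)²`, `j ≥ 1`. -/
def eigval (j : ℕ) : ℝ := (j * Real.pi) ^ 2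

/-- The eigenvectors `φ_j = √2 sin(jπ·)`, `j ≥ 1`. -/
def eigvec (j : ℕ) (x : ℝ) : ℝ := Real.sqrt 2 * Real.sin (j * Real.pi * x)

/-- The matrix element `⟨μ φ_i, φ_j⟩`. -/
def matElem (μ : ℝ → ℝ) (i j : ℕ) : ℝ := ip (fun x => μ x * eigvec i x) (eigvec j)

/-- The product `⟨μ φ_1, φ_j⟩ ⟨ν φ_j, φ_K⟩`. -/
def quadCoef (μ ν : ℝ → ℝ) (K j : ℕ) : ℝ := matElem μ 1 j * matElem ν j K

/-! ### The quadratic coefficients -/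

/-- The `j`-th term (`j ≥ 1`) of the series in `A_k(μ)`. -/
def termA (μ : ℝ → ℝ) (K k j : ℕ) : ℝ :=
  (eigval j - (eigval 1 + eigval K) / 2) * (eigval K - eigval j) ^ (k - 1)
    * (eigval j - eigval 1) ^ (k - 1) * quadCoef μ μ K j

/-- `A_k(μ)`, for `k ≥ 1`; the series runs over the indices `j + 1 ≥ 1`. -/
def coefA (μ : ℝ → ℝ) (K k : ℕ) : ℝ := (-1) ^ (k - 1) * ∑' j : ℕ, termA μ K k (j + 1)

/-- The `j`-th term (`j ≥ 1`) of the series `γ_k`. -/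
def termGamma (μ₁ μ₂ : ℝ → ℝ) (K k j : ℕ) : ℝ :=
  (eigval K - eigval j) ^ ((k + 1) / 2) * (eigval j - eigval 1) ^ (k / 2) * quadCoef μ₂ μ₁ K j
    - (eigval K - eigval j) ^ (k / 2) * (eigval j - eigval 1) ^ ((k + 1) / 2) * quadCoef μ₁ μ₂ K j

/-- `γ_k`, for `k ≥ 1`; the series runs over the indices `j + 1 ≥ 1`. -/
def coefGamma (μ₁ μ₂ : ℝ → ℝ) (K k : ℕ) : ℝ := ∑' j : ℕ, termGamma μ₁ μ₂ K k (j + 1)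

/-! ### The hypotheses on the dipolar moments

Each assertion on the sum of a series includes its absolute convergence
(`Summable` means absolutely convergent for series of real numbers). -/

/-- `(H)_reg`. -/
def HReg (p m : ℕ) (μ₁ μ₂ : ℝ → ℝ) : Prop :=
  (MemH (2 * (p + m) + 3) μ₁ ∧ ∀ k < p, DerivVanishesAtBoundary (2 * k + 1) μ₁) ∧
    (MemH (2 * (p + m) + 3) μ₂ ∧ ∀ k < p, DerivVanishesAtBoundary (2 * k + 1) μ₂)

/-- `(H)_{lin,K,1}`. -/
def HLin1 (K : ℕ) (μ₁ μ₂ : ℝ → ℝ) : Prop := matElem μ₁ 1 K = 0 ∧ matElem μ₂ 1 K = 0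

/-- `(H)_{lin,K,2}`. -/
def HLin2 (p K : ℕ) (μ₁ μ₂ : ℝ → ℝ) : Prop :=
  ∃ C : ℝ, 0 < C ∧ ∀ j : ℕ, 1 ≤ j → j ≠ K →
    C / (j : ℝ) ^ (2 * p + 3) ≤ Real.sqrt (matElem μ₁ 1 j ^ 2 + matElem μ₂ 1 j ^ 2)

/-- `(H)_{quad,K,1}` with `μ = μ₁`, and `(H)_{quad,K,2}` with `μ = μ₂`. -/
def HQuadA (n K : ℕ) (μ : ℝ → ℝ) : Prop :=
  ∀ k : ℕ, 1 ≤ k → k ≤ (n + 1) / 2 →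
    Summable (fun j : ℕ => termA μ K k (j + 1)) ∧ coefA μ K k = 0

/-- `(H)_{quad,K,3}`. -/
def HQuad3 (n K : ℕ) (μ₁ μ₂ : ℝ → ℝ) : Prop :=
  ∀ k : ℕ, 1 ≤ k → k ≤ n - 1 →
    Summable (fun j : ℕ => termGamma μ₁ μ₂ K k (j + 1)) ∧ coefGamma μ₁ μ₂ K k = 0

/-- `(H)_{quad,K,4}`. -/
def HQuad4 (n K : ℕ) (μ₁ μ₂ : ℝ → ℝ) : Prop :=
  Summable (fun j : ℕ => termGamma μ₁ μ₂ K n (j + 1)) ∧ coefGamma μ₁ μ₂ K n ≠ 0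

end

end BilinearSchrodinger

namespace BilinearSchrodinger

open intervalIntegral

/-! ### Smooth functions are Sobolev functions -/

/-! In terms of the cosine coefficients `m` of `μ`, the matrix element `⟨μ φ_i, φ_j⟩` is `m |i - j|
- m (i + j)`. Any sequence equal to `c / k ^ s` for large `k`, with `s = 2p + 2`, comes from a
smooth `μ` with the required boundary conditions (`isCosRealizable_of_eventually`), so the problem
is one about sequences.

Since `λ_j - λ_1 = (λ_K - λ_1) - (λ_K - λ_j)`, the series in `A_k` and `γ_k` are brackets `B_α(m,
m')`, linear in a polynomial `α`; `γ_k` has `α` of degree exactly `k`, and `A_k` has `α`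
antisymmetric under `x ↦ λ_K - λ_1 - x`. If `m` has tail `k ^ (-s)` and `m'` is a single cosine of
large frequency `e`, the bracket is an explicit rational function of `e`. Unless `α` is constant,
this function has a pole, because `deg α ≤ n < s`. By duality, finitely many large frequencies,
taken among the multiples of `2K + 2`, realize every linear form on polynomials of degree at most
`n` that kills constants (`exists_finsupp_hasSum_bracketTerm`). Such multiples have no quadratic
interaction with one another (`cosMat_mul_cosMat_eq_zero`).

For `μ₁`, start from an explicit `v` with the right linear behaviour and add a perturbation `b` with
`B_α(v, b) = -B_α(v, v) / 2`; for antisymmetric `α` the bracket is symmetric, so `B_α(v + b, v + b)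
= 0`. A free parameter in `b` keeps the linear coefficients nonzero. For `μ₂`, take a finite cosine
sum whose bracket with `μ₁` is the coefficient of `X ^ n` in `α`: this kills `γ_k` for `k < n` and
makes `γ_n` a leading coefficient. -/

lemma IsTestFunction.iteratedDeriv_eq_zero {φ : ℝ → ℝ} (hφ : IsTestFunction φ) (i : ℕ) {x : ℝ}
    (hx : x ∉ Set.Ioo (0 : ℝ) 1) : iteratedDeriv i φ x = 0 := by
  have h : x ∉ tsupport φ := fun h => hx (hφ.2.2 h)
  rw [notMem_tsupport_iff_eventuallyEq] at h
  rw [h.iteratedDeriv_eq i]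
  simp [Pi.zero_def]

lemma isWeakDeriv_iteratedDeriv {f : ℝ → ℝ} (hf : ContDiff ℝ ∞ f) (i : ℕ) :
    IsWeakDeriv i f (iteratedDeriv i f) := by
  intro φ hφ
  induction i generalizing f with
  | zero => simp
  | succ i ih =>
    have hf' := contDiff_infty_iff_deriv.1 hf
    have hφi : ContDiff ℝ 1 (iteratedDeriv i φ) :=
      ContDiff.iterate_deriv' 1 i (hφ.1.of_le (by exact_mod_cast le_top)) |> fun h => by
        rwa [← iteratedDeriv_eq_iterate] at h
    have key := integral_mul_deriv_eq_deriv_mul (a := 0) (b := 1) (u := f) (u' := deriv f)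
      (v := iteratedDeriv i φ) (v' := iteratedDeriv (i + 1) φ)
      (fun x _ => (hf'.1 x).hasDerivAt)
      (fun x _ => by
        rw [iteratedDeriv_succ]
        exact (hφi.differentiable one_ne_zero x).hasDerivAt)
      (hf'.2.continuous.intervalIntegrable _ _)
      (by rw [iteratedDeriv_succ]
          exact (hφi.continuous_deriv le_rfl).intervalIntegrable _ _)
    rw [key, hφ.iteratedDeriv_eq_zero i (by simp), hφ.iteratedDeriv_eq_zero i (by simp),
      ih hf'.2, iteratedDeriv_succ' (f := f)]
    ring

lemma memL2_of_continuous {f : ℝ → ℝ} (hf : Continuous f) : MemL2 f := by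
  obtain ⟨C, hC⟩ := isCompact_Icc.exists_bound_of_continuousOn (s := Set.Icc (0 : ℝ) 1)
    hf.continuousOn
  refine MeasureTheory.MemLp.of_bound hf.aestronglyMeasurable C ?_
  filter_upwards [MeasureTheory.ae_restrict_mem measurableSet_Ioo] with x hx
  exact hC x (Set.Ioo_subset_Icc_self hx)

lemma continuous_iteratedDeriv_of_smooth {f : ℝ → ℝ} (hf : ContDiff ℝ ∞ f) (i : ℕ) :
    Continuous (iteratedDeriv i f) :=
  hf.continuous_iteratedDeriv i (by exact_mod_cast le_top)

lemma memH_of_smooth {f : ℝ → ℝ} (hf : ContDiff ℝ ∞ f) (s : ℕ) : MemH s f :=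
  ⟨memL2_of_continuous hf.continuous, fun i _ =>
    ⟨iteratedDeriv i f, memL2_of_continuous (continuous_iteratedDeriv_of_smooth hf i),
      isWeakDeriv_iteratedDeriv hf i⟩⟩

/-! ### Cosine coefficients -/

/-- The cosine coefficient `∫₀¹ μ cos(kπ·)`. -/
noncomputable def cosCoef (μ : ℝ → ℝ) (k : ℕ) : ℝ :=
  ∫ x in (0 : ℝ)..1, μ x * Real.cos (k * Real.pi * x)

/-- The matrix element attached to a sequence of cosine coefficients. -/
def cosMat (m : ℕ → ℝ) (i j : ℕ) : ℝ := m (i - j + (j - i)) - m (i + j)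

lemma cosMat_comm (m : ℕ → ℝ) (i j : ℕ) : cosMat m i j = cosMat m j i := by
  simp only [cosMat, add_comm]

/-- With truncated subtraction, `i - j + (j - i)` is `|i - j|`. -/
lemma two_mul_sin_mul_sin (i j : ℕ) (x : ℝ) :
    2 * Real.sin (i * Real.pi * x) * Real.sin (j * Real.pi * x)
      = Real.cos ((i - j + (j - i) : ℕ) * Real.pi * x) - Real.cos ((i + j : ℕ) * Real.pi * x) := by
  have h : Real.cos ((i - j + (j - i) : ℕ) * Real.pi * x)
      = Real.cos (i * Real.pi * x - j * Real.pi * x) := by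
    rcases le_total i j with h | h
    · rw [Nat.sub_eq_zero_of_le h, zero_add, Nat.cast_sub h, ← Real.cos_neg]
      congr 1; ring
    · rw [Nat.sub_eq_zero_of_le h, add_zero, Nat.cast_sub h]
      congr 1; ring
  rw [h, Nat.cast_add, add_mul, add_mul, Real.cos_add, Real.cos_sub]
  ring

lemma matElem_eq_cosMat {μ : ℝ → ℝ} (hμ : Continuous μ) (i j : ℕ) :
    matElem μ i j = cosMat (cosCoef μ) i j := by
  unfold matElem ip cosMat cosCoef
  rw [← integral_sub]
  · refine integral_congr fun x _ => ?_
    simp only [eigvec]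
    rw [← mul_sub, ← two_mul_sin_mul_sin]
    have : Real.sqrt 2 * Real.sqrt 2 = 2 := Real.mul_self_sqrt (by norm_num)
    linear_combination (μ x * Real.sin (i * Real.pi * x) * Real.sin (j * Real.pi * x)) * this
  all_goals exact Continuous.intervalIntegrable (by fun_prop) _ _

lemma integral_cos_nat_mul_pi {k : ℕ} (hk : k ≠ 0) :
    ∫ x in (0 : ℝ)..1, Real.cos (k * Real.pi * x) = 0 := by
  have : (k * Real.pi : ℝ) ≠ 0 := by positivity
  rw [integral_comp_mul_left (fun x => Real.cos x) this]
  simp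

/-- Two integrations by parts; the boundary values of `f` drop out because `sin (kπ) = 0`. When `f'`
vanishes at both ends, this trades two derivatives for a factor `k ^ (-2)`. -/
lemma cosCoef_eq_deriv_deriv {f : ℝ → ℝ} (hf : ContDiff ℝ ∞ f) {k : ℕ} (hk : k ≠ 0) :
    cosCoef f k = (deriv f 1 * (-1) ^ k - deriv f 0 - cosCoef (deriv (deriv f)) k)
      / (k * Real.pi) ^ 2 := by
  have hw : (k * Real.pi : ℝ) ≠ 0 := by positivity
  have hf' := contDiff_infty_iff_deriv.1 hf
  have hf'' := contDiff_infty_iff_deriv.1 hf'.2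
  set w : ℝ := k * Real.pi with hwdef
  have h1 := integral_mul_deriv_eq_deriv_mul (a := 0) (b := 1) (u := f) (u' := deriv f)
      (v := fun x => Real.sin (w * x) / w) (v' := fun x => Real.cos (w * x))
      (fun x _ => (hf'.1 x).hasDerivAt)
      (fun x _ => by
        refine (((hasDerivAt_id' x).const_mul w).sin.div_const w).congr_deriv ?_
        field_simp)
      (hf'.2.continuous.intervalIntegrable _ _)
      (Continuous.intervalIntegrable (by fun_prop) _ _)
  have h2 := integral_mul_deriv_eq_deriv_mul (a := 0) (b := 1) (u := deriv f)
      (u' := deriv (deriv f))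
      (v := fun x => -Real.cos (w * x) / w ^ 2) (v' := fun x => Real.sin (w * x) / w)
      (fun x _ => (hf''.1 x).hasDerivAt)
      (fun x _ => by
        refine ((((hasDerivAt_id' x).const_mul w).cos.neg).div_const (w ^ 2)).congr_deriv ?_
        field_simp)
      (hf''.2.continuous.intervalIntegrable _ _)
      (Continuous.intervalIntegrable (by fun_prop) _ _)
  have hs : Real.sin w = 0 := by rw [hwdef]; exact Real.sin_nat_mul_pi k
  have hc : Real.cos w = (-1) ^ k := by rw [hwdef]; exact Real.cos_nat_mul_pi k
  have h3 : ∫ x in (0 : ℝ)..1, deriv (deriv f) x * (-Real.cos (w * x) / w ^ 2)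
      = -cosCoef (deriv (deriv f)) k / w ^ 2 := by
    rw [cosCoef, ← hwdef, ← intervalIntegral.integral_neg, ← integral_div]
    refine integral_congr fun x _ => ?_
    ring
  rw [h2, h3] at h1
  simp only [mul_one, mul_zero, hs, hc, Real.sin_zero, Real.cos_zero, zero_div, zero_sub,
    sub_zero] at h1
  rw [cosCoef, ← hwdef, h1]
  field_simp
  ring

/-! ### Sequences realized as cosine coefficients -/

/-- `m` is the sequence of cosine coefficients of a smooth function whose odd derivatives of order
less than `2p` vanish at `0` and `1`. -/
def IsCosRealizable (p : ℕ) (m : ℕ → ℝ) : Prop :=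
  ∃ μ : ℝ → ℝ, ContDiff ℝ ∞ μ ∧ cosCoef μ = m ∧
    ∀ i < p, iteratedDeriv (2 * i + 1) μ 0 = 0 ∧ iteratedDeriv (2 * i + 1) μ 1 = 0

lemma IsCosRealizable.add {p : ℕ} {m m' : ℕ → ℝ} (h : IsCosRealizable p m)
    (h' : IsCosRealizable p m') : IsCosRealizable p (m + m') := by
  obtain ⟨f, hf, rfl, hfb⟩ := h
  obtain ⟨g, hg, rfl, hgb⟩ := h'
  refine ⟨f + g, hf.add hg, ?_, fun i hi => ?_⟩
  · have := hf.continuous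
    have := hg.continuous
    ext k
    simp only [cosCoef, Pi.add_apply, add_mul]
    rw [integral_add]
    all_goals exact Continuous.intervalIntegrable (by fun_prop) _ _
  · have h1 : ∀ x, ContDiffAt ℝ (2 * i + 1 : ℕ) f x := fun x =>
      (contDiff_infty.1 hf _).contDiffAt
    have h2 : ∀ x, ContDiffAt ℝ (2 * i + 1 : ℕ) g x := fun x =>
      (contDiff_infty.1 hg _).contDiffAt
    rw [iteratedDeriv_add (h1 _) (h2 _), iteratedDeriv_add (h1 _) (h2 _), (hfb i hi).1,
      (hfb i hi).2, (hgb i hi).1, (hgb i hi).2]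
    simp

lemma IsCosRealizable.const_smul {p : ℕ} {m : ℕ → ℝ} (h : IsCosRealizable p m) (c : ℝ) :
    IsCosRealizable p (c • m) := by
  obtain ⟨f, hf, rfl, hfb⟩ := h
  refine ⟨fun x => c * f x, contDiff_const.mul hf, ?_, fun i hi => ?_⟩
  · ext k
    simp only [cosCoef, Pi.smul_apply, smul_eq_mul, mul_assoc]
    exact intervalIntegral.integral_const_mul _ _
  · rw [iteratedDeriv_const_mul_field, iteratedDeriv_const_mul_field]
    simp [hfb i hi]

lemma IsCosRealizable.sum {p : ℕ} {ι : Type*} (s : Finset ι) (m : ι → ℕ → ℝ)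
    (h : ∀ i ∈ s, IsCosRealizable p (m i)) : IsCosRealizable p (∑ i ∈ s, m i) := by
  refine Finset.sum_induction _ _ (fun _ _ => IsCosRealizable.add) ⟨0, contDiff_const, ?_, ?_⟩ h
  · ext k; simp [cosCoef]
  · intro i _; simp [Pi.zero_def]

lemma iteratedDeriv_odd_cos_mul (k i : ℕ) (x : ℝ) (hx : Real.sin (k * Real.pi * x) = 0) :
    iteratedDeriv (2 * i + 1) (fun x => Real.cos (k * Real.pi * x)) x = 0 := by
  rw [iteratedDeriv_comp_const_mul (Real.contDiff_cos.of_le le_top), Real.iteratedDeriv_odd_cos]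
  simp [hx]

lemma cosCoef_cos (l k : ℕ) :
    cosCoef (fun x => Real.cos (l * Real.pi * x)) k
      = if k = l then (if l = 0 then 1 else 1 / 2) else 0 := by
  have h : cosCoef (fun x => Real.cos (l * Real.pi * x)) k
      = (∫ x in (0 : ℝ)..1, Real.cos ((l - k + (k - l) : ℕ) * Real.pi * x)) / 2
        + (∫ x in (0 : ℝ)..1, Real.cos ((l + k : ℕ) * Real.pi * x)) / 2 := by
    rw [cosCoef, ← integral_div, ← integral_div, ← integral_add]
    · refine integral_congr fun x _ => ?_
      have h1 := two_mul_sin_mul_sin l k x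
      have h2 : Real.cos ((l + k : ℕ) * Real.pi * x) = Real.cos (l * Real.pi * x)
        * Real.cos (k * Real.pi * x) - Real.sin (l * Real.pi * x) * Real.sin (k * Real.pi * x) := by
        rw [← Real.cos_add]; push_cast; ring_nf
      linear_combination h1 / 2 - h2
    all_goals exact Continuous.intervalIntegrable (by fun_prop) _ _
  rw [h]
  by_cases hkl : k = l
  · subst hkl
    by_cases hk : k = 0
    · subst hk; simp; norm_num
    · rw [integral_cos_nat_mul_pi (k := k + k) (by omega)]
      simp [hk]
  · rw [integral_cos_nat_mul_pi (by omega), integral_cos_nat_mul_pi (by omega)]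
    simp [hkl]

lemma isCosRealizable_single (p l : ℕ) : IsCosRealizable p (Pi.single l 1) := by
  have h : IsCosRealizable p (cosCoef (fun x => Real.cos (l * Real.pi * x))) := by
    refine ⟨_, by fun_prop, rfl, fun i _ => ⟨?_, ?_⟩⟩
    · exact iteratedDeriv_odd_cos_mul l i 0 (by simp)
    · exact iteratedDeriv_odd_cos_mul l i 1 (by simp)
  convert h.const_smul (if l = 0 then 1 else 2) using 1
  ext k
  simp only [Pi.smul_apply, cosCoef_cos, Pi.single_apply, smul_eq_mul]
  split_ifs <;> simp

lemma exists_smooth_antideriv {f : ℝ → ℝ} (hf : ContDiff ℝ ∞ f) :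
    ∃ F : ℝ → ℝ, ContDiff ℝ ∞ F ∧ deriv F = f ∧ ∀ x, F x = ∫ t in (0 : ℝ)..x, f t := by
  have h : ∀ x, HasDerivAt (fun x => ∫ t in (0 : ℝ)..x, f t) (f x) x := fun x =>
    integral_hasDerivAt_right (hf.continuous.intervalIntegrable _ _)
      (hf.continuous.stronglyMeasurableAtFilter _ _) hf.continuous.continuousAt
  have h' : deriv (fun x => ∫ t in (0 : ℝ)..x, f t) = f := funext fun x => (h x).deriv
  exact ⟨_, contDiff_infty_iff_deriv.2 ⟨fun x => (h x).differentiableAt, by rwa [h']⟩, h',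
    fun _ => rfl⟩

lemma exists_isCosRealizable_inv_pow (p : ℕ) :
    ∃ m : ℕ → ℝ, IsCosRealizable p m ∧ ∀ k, k ≠ 0 → m k = 1 / (k : ℝ) ^ (2 * p + 2) := by
  induction p with
  | zero =>
    -- The second derivative of this parabola is constant, its slope is `0` at `1` and `-π²` at `0`,
    -- so the coefficient is `π² / (kπ)²`.
    refine ⟨_, ⟨fun x => Real.pi ^ 2 / 2 * (x - 1) ^ 2, by fun_prop, rfl, by simp⟩,
      fun k hk => ?_⟩
    have h1 : deriv (fun x : ℝ => Real.pi ^ 2 / 2 * (x - 1) ^ 2)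
        = fun x => Real.pi ^ 2 * (x - 1) := by
      ext x
      have := ((((hasDerivAt_id x).sub_const 1).pow 2).const_mul (Real.pi ^ 2 / 2)).deriv
      simp only [id, Pi.pow_apply] at this
      refine Eq.trans this ?_
      simp; ring
    have h2 : deriv (fun x : ℝ => Real.pi ^ 2 * (x - 1)) = fun x => Real.pi ^ 2 := by
      ext x
      have := (((hasDerivAt_id x).sub_const 1).const_mul (Real.pi ^ 2)).deriv
      simp
    rw [cosCoef_eq_deriv_deriv (by fun_prop) hk, h1, h2]
    simp only [cosCoef, intervalIntegral.integral_const_mul, integral_cos_nat_mul_pi hk]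
    have := Real.pi_ne_zero
    field_simp
    simp
  | succ p ih =>
    obtain ⟨m, ⟨f, hf, rfl, hfb⟩, hm⟩ := ih
    -- Solve the Neumann problem `F'' = -π² (f - A)`, `F'(0) = F'(1) = 0`. Subtracting the mean `A`
    -- makes it solvable and does not affect the coefficients with `k ≠ 0`; the higher odd
    -- derivatives of `F` inherit their boundary values from `f`.
    set A := ∫ t in (0 : ℝ)..1, f t with hA
    have hg : ContDiff ℝ ∞ (fun x => -Real.pi ^ 2 * (f x - A)) := by fun_prop
    obtain ⟨G, hG, hG', hG0⟩ := exists_smooth_antideriv hg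
    obtain ⟨F, hF, hF', -⟩ := exists_smooth_antideriv hG
    have hG00 : G 0 = 0 := by simp [hG0]
    have hG1 : G 1 = 0 := by
      rw [hG0, intervalIntegral.integral_const_mul, integral_sub
        (hf.continuous.intervalIntegrable _ _) (by simp), ← hA]
      simp
    refine ⟨_, ⟨F, hF, rfl, fun i hi => ?_⟩, fun k hk => ?_⟩
    · rcases i with _ | i
      · simp [hF', hG00, hG1]
      · have : 2 * (i + 1) + 1 = (2 * i + 1) + 1 + 1 := by ring
        have h2 : ∀ x, iteratedDeriv (2 * i + 1) (fun x => -Real.pi ^ 2 * (f x - A)) x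
            = -Real.pi ^ 2 * iteratedDeriv (2 * i + 1) f x := by
          intro x
          rw [iteratedDeriv_const_mul_field]
          congr 1
          rw [iteratedDeriv_succ', iteratedDeriv_succ']
          simp
        rw [this, iteratedDeriv_succ', iteratedDeriv_succ', hF', hG', h2, h2]
        simp [hfb i (by omega)]
    · rw [cosCoef_eq_deriv_deriv hF hk, hF', hG', hG00, hG1]
      have h3 : cosCoef (fun x => -Real.pi ^ 2 * (f x - A)) k = -Real.pi ^ 2 * cosCoef f k := by
        simp only [cosCoef, mul_assoc, intervalIntegral.integral_const_mul, sub_mul]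
        rw [integral_sub, intervalIntegral.integral_const_mul]
        · simp only [← mul_assoc, integral_cos_nat_mul_pi hk]
          simp
        · have := hf.continuous
          exact Continuous.intervalIntegrable (by fun_prop) _ _
        · exact Continuous.intervalIntegrable (by fun_prop) _ _
      rw [h3, hm k hk]
      have := Real.pi_ne_zero
      field_simp
      ring

/-- A multiple of the model function has the right tail; the finitely many remaining coefficients
are corrected by cosines, all of whose odd derivatives vanish at the end points. -/
lemma isCosRealizable_of_eventually {p N : ℕ} {m : ℕ → ℝ} {c : ℝ}
    (hm : ∀ k ≥ N, m k = c / (k : ℝ) ^ (2 * p + 2)) : IsCosRealizable p m := by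
  obtain ⟨r, hr, hrk⟩ := exists_isCosRealizable_inv_pow p
  have h := (hr.const_smul c).add (IsCosRealizable.sum (Finset.range (N + 1))
    (fun k => (m k - c * r k) • Pi.single k 1) fun k _ => (isCosRealizable_single p k).const_smul _)
  convert h using 1
  ext k
  simp only [Pi.add_apply, Pi.smul_apply, smul_eq_mul, Finset.sum_apply, Pi.single_apply,
    mul_ite, mul_one, mul_zero, Finset.sum_ite_eq, Finset.mem_range]
  split_ifs with h
  · ring
  · rw [hm k (by omega), hrk k (by omega)]
    ring

open Polynomial

/-! ### Brackets of sequences of cosine coefficients -/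

/-- The `j`-th term of the series attached to a polynomial `α` and to two sequences of cosine
coefficients; the series in `γ_k` and `A_k` are of this form. -/
noncomputable def bracketTerm (α : ℝ[X]) (K : ℕ) (m m' : ℕ → ℝ) (j : ℕ) : ℝ :=
  α.eval (eigval K - eigval j) * (cosMat m' 1 j * cosMat m j K)
    - α.eval (eigval j - eigval 1) * (cosMat m 1 j * cosMat m' j K)

/-- The sum of the bracket series of `k ↦ 1 / k ^ s` with a single cosine of frequency `x`. -/
noncomputable def bracketSymbol (α : ℝ[X]) (K s : ℕ) (x : ℝ) : ℝ :=
  α.eval ((K * Real.pi) ^ 2 - ((x + 1) * Real.pi) ^ 2) *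
      (1 / (x + 1 - K) ^ s - 1 / (x + 1 + K) ^ s)
    - α.eval ((K * Real.pi) ^ 2 - ((x - 1) * Real.pi) ^ 2) *
      (1 / (x - 1 - K) ^ s - 1 / (x - 1 + K) ^ s)
    - (α.eval (((x + K) * Real.pi) ^ 2 - (1 * Real.pi) ^ 2) *
      (1 / (x + K - 1) ^ s - 1 / (x + K + 1) ^ s)
    - α.eval (((x - K) * Real.pi) ^ 2 - (1 * Real.pi) ^ 2) *
      (1 / (x - K - 1) ^ s - 1 / (x - K + 1) ^ s))

lemma bracketTerm_one (K : ℕ) (m : ℕ → ℝ) : bracketTerm 1 K m m = 0 := by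
  ext j; simp [bracketTerm]

/-- `bracketTerm` as a linear map in the polynomial. -/
noncomputable def bracketTermLin (K : ℕ) (m m' : ℕ → ℝ) : ℝ[X] →ₗ[ℝ] (ℕ → ℝ) where
  toFun α := bracketTerm α K m m'
  map_add' α β := by ext j; simp only [bracketTerm, eval_add, Pi.add_apply]; ring
  map_smul' c α := by
    ext j; simp only [bracketTerm, eval_smul, Pi.smul_apply, smul_eq_mul, RingHom.id_apply]; ring

/-- `bracketSymbol` as a linear form in the polynomial. -/
noncomputable def bracketSymbolLin (K s : ℕ) (x : ℝ) : ℝ[X] →ₗ[ℝ] ℝ where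
  toFun α := bracketSymbol α K s x
  map_add' α β := by simp only [bracketSymbol, eval_add]; ring
  map_smul' c α := by
    simp only [bracketSymbol, eval_smul, smul_eq_mul, RingHom.id_apply]; ring

/-- For constant `α` the two halves of the symbol consist of the same four reciprocal powers and
cancel. -/
lemma bracketSymbol_sub_C (α : ℝ[X]) (c : ℝ) (K s : ℕ) (x : ℝ) :
    bracketSymbol (α - C c) K s x = bracketSymbol α K s x := by
  have h1 : x + 1 - K = x - K + 1 := by ring
  have h2 : x + 1 + K = x + K + 1 := by ring
  have h3 : x - 1 - K = x - K - 1 := by ring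
  have h4 : x - 1 + K = x + K - 1 := by ring
  simp only [bracketSymbol, eval_sub, eval_C, h1, h2, h3, h4]
  ring

/-- The polynomial identity expressing that the symbol vanishes, in the variable `t = x - K + 1`. -/
lemma eval_eq_zero_of_bracketSymbol_eq_zero {β : ℝ[X]} {K s : ℕ} {x t : ℝ} (hx : K + 1 < x)
    (hK : 2 ≤ K) (ht : t = x - K + 1) (h : bracketSymbol β K s x = 0) :
    (β.eval (Real.pi ^ 2 * (-t * (t + 2 * K))) - β.eval (Real.pi ^ 2 * (t * (t - 2)))) *
        ((t - 2) ^ s * (t + 2 * K - 2) ^ s * (t + 2 * K) ^ s)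
      + t ^ s * ((β.eval (Real.pi ^ 2 * (t * (t - 2)))
            - β.eval (Real.pi ^ 2 * (K ^ 2 - (t + K - 2) ^ 2))) *
          ((t + 2 * K - 2) ^ s * (t + 2 * K) ^ s)
        + (β.eval (Real.pi ^ 2 * (K ^ 2 - (t + K - 2) ^ 2))
            - β.eval (Real.pi ^ 2 * ((t + 2 * K - 1) ^ 2 - 1))) *
          ((t - 2) ^ s * (t + 2 * K) ^ s)
        + (β.eval (Real.pi ^ 2 * ((t + 2 * K - 1) ^ 2 - 1))
            - β.eval (Real.pi ^ 2 * (-t * (t + 2 * K)))) *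
          ((t - 2) ^ s * (t + 2 * K - 2) ^ s)) = 0 := by
  have hK' : (2 : ℝ) ≤ K := by exact_mod_cast hK
  obtain rfl : x = t + K - 1 := by linarith
  have e1 : ((K : ℝ) * Real.pi) ^ 2 - ((t + K - 1 + 1) * Real.pi) ^ 2
      = Real.pi ^ 2 * (-t * (t + 2 * K)) := by ring
  have e2 : ((K : ℝ) * Real.pi) ^ 2 - ((t + K - 1 - 1) * Real.pi) ^ 2
      = Real.pi ^ 2 * (K ^ 2 - (t + K - 2) ^ 2) := by ring
  have e3 : ((t + K - 1 + K) * Real.pi) ^ 2 - (1 * Real.pi) ^ 2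
      = Real.pi ^ 2 * ((t + 2 * K - 1) ^ 2 - 1) := by ring
  have e4 : ((t + K - 1 - K) * Real.pi) ^ 2 - (1 * Real.pi) ^ 2
      = Real.pi ^ 2 * (t * (t - 2)) := by ring
  have f1 : t + K - 1 + 1 - K = t := by ring
  have f2 : t + K - 1 + 1 + K = t + 2 * K := by ring
  have f3 : t + K - 1 - 1 - K = t - 2 := by ring
  have f4 : t + K - 1 - 1 + K = t + 2 * K - 2 := by ring
  have f5 : t + K - 1 + K - 1 = t + 2 * K - 2 := by ring
  have f6 : t + K - 1 + K + 1 = t + 2 * K := by ring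
  have f7 : t + K - 1 - K - 1 = t - 2 := by ring
  have f8 : t + K - 1 - K + 1 = t := by ring
  rw [bracketSymbol, e1, e2, e3, e4, f1, f2, f3, f4, f5, f6, f7, f8] at h
  have g1 : t ^ s ≠ 0 := pow_ne_zero _ (by linarith)
  have g2 : (t + 2 * K) ^ s ≠ 0 := pow_ne_zero _ (by linarith)
  have g3 : (t + 2 * K - 2) ^ s ≠ 0 := pow_ne_zero _ (by linarith)
  have g4 : (t - 2) ^ s ≠ 0 := pow_ne_zero _ (by linarith)
  generalize β.eval (Real.pi ^ 2 * (-t * (t + 2 * K))) = b1 at *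
  generalize β.eval (Real.pi ^ 2 * (K ^ 2 - (t + K - 2) ^ 2)) = b2 at *
  generalize β.eval (Real.pi ^ 2 * ((t + 2 * K - 1) ^ 2 - 1)) = b3 at *
  generalize β.eval (Real.pi ^ 2 * (t * (t - 2))) = b4 at *
  generalize t ^ s = u1 at *
  generalize (t + 2 * K) ^ s = u2 at *
  generalize (t + 2 * K - 2) ^ s = u3 at *
  generalize (t - 2) ^ s = u4 at *
  field_simp at h
  linear_combination h

/-- A bracket symbol that vanishes on an infinite set belongs to a constant polynomial: otherwise
it has a pole at `x = K - 1`. -/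
lemma natDegree_eq_zero_of_bracketSymbol {α : ℝ[X]} {K s : ℕ} (hK : 2 ≤ K)
    (hα : α.natDegree < s) {T : Set ℝ} (hT : T.Infinite)
    (h : ∀ x ∈ T, K + 1 < x ∧ bracketSymbol α K s x = 0) : α.natDegree = 0 := by
  by_contra hdeg
  have hK' : (2 : ℝ) ≤ K := by exact_mod_cast hK
  -- Normalize `α` to vanish at `0`, to an order `i` with `1 ≤ i ≤ deg α < s`.
  set β : ℝ[X] := α - C (α.eval 0) with hβ
  have hβdeg : β.natDegree = α.natDegree := natDegree_sub_C
  have hβ0 : β ≠ 0 := by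
    intro h0; rw [h0, natDegree_zero] at hβdeg; omega
  obtain ⟨ρ, hρ, hρ0⟩ := exists_eq_pow_rootMultiplicity_mul_and_not_dvd β hβ0 0
  set i := rootMultiplicity 0 β with hi
  rw [dvd_iff_isRoot, IsRoot.def] at hρ0
  rw [C_0, sub_zero] at hρ
  have hipos : 1 ≤ i := by
    rw [hi, Nat.one_le_iff_ne_zero, ← Nat.pos_iff_ne_zero, rootMultiplicity_pos hβ0]
    simp [hβ]
  have his : i < s := by
    have hρne : ρ ≠ 0 := by rintro rfl; simp at hρ0
    have := congrArg natDegree hρ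
    rw [natDegree_mul (pow_ne_zero _ X_ne_zero) hρne, natDegree_X_pow] at this
    omega
  have hβev : ∀ y, β.eval y = y ^ i * ρ.eval y := fun y => by
    rw [hρ]; simp
  set c : ℝ[X] := C (Real.pi ^ 2) with hc
  set k : ℝ[X] := C (K : ℝ) with hk
  set H : ℝ[X] := ((β.comp (c * (X * (X - 2)))
            - β.comp (c * (k ^ 2 - (X + k - 2) ^ 2))) *
          ((X + 2 * k - 2) ^ s * (X + 2 * k) ^ s)
        + (β.comp (c * (k ^ 2 - (X + k - 2) ^ 2))
            - β.comp (c * ((X + 2 * k - 1) ^ 2 - 1))) *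
          ((X - 2) ^ s * (X + 2 * k) ^ s)
        + (β.comp (c * ((X + 2 * k - 1) ^ 2 - 1))
            - β.comp (c * (-X * (X + 2 * k)))) *
          ((X - 2) ^ s * (X + 2 * k - 2) ^ s)) with hH
  set W : ℝ[X] := (X - 2) ^ s * (X + 2 * k - 2) ^ s * (X + 2 * k) ^ s with hW
  -- The two arguments of `β` that multiply `1 / t ^ s` are divisible by `t`, so `t ^ i` factors out
  -- of the cleared identity; `G` is the cofactor. The other terms keep `t ^ (s - i)` with `s - i >
  -- 0`, so `G(0)` sees only the polar part.
  set G : ℝ[X] := (c ^ i * (-(X + 2 * k)) ^ i * ρ.comp (c * (-X * (X + 2 * k)))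
      - c ^ i * (X - 2) ^ i * ρ.comp (c * (X * (X - 2)))) * W + X ^ (s - i) * H with hG
  have hroot : ∀ x ∈ T, (G * X ^ i).IsRoot (x - K + 1) := by
    intro x hx
    obtain ⟨hx1, hx0⟩ := h x hx
    have hx0' : bracketSymbol β K s x = 0 := by rw [hβ, bracketSymbol_sub_C, hx0]
    have key := eval_eq_zero_of_bracketSymbol_eq_zero hx1 hK rfl hx0'
    set t := x - K + 1 with ht
    have hts : t ^ s = t ^ (s - i) * t ^ i := by rw [← pow_add]; congr 1; omega
    rw [IsRoot.def]
    refine Eq.trans ?_ key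
    rw [hts, hβev (Real.pi ^ 2 * (-t * (t + 2 * K))), hβev (Real.pi ^ 2 * (t * (t - 2)))]
    simp only [hG, hW, hH, hc, hk, eval_add, eval_mul, eval_sub, eval_pow, eval_X, eval_C,
      eval_comp, eval_neg, eval_ofNat, eval_one, mul_pow, neg_mul, hβev,
      neg_pow (t + 2 * (K : ℝ)), neg_pow (t * (t + 2 * (K : ℝ)))]
    ring
  have hG0 : G = 0 := by
    have hinf : (G * X ^ i) = 0 := by
      refine eq_zero_of_infinite_isRoot _ (Set.Infinite.mono ?_
        (hT.image (f := fun x : ℝ => x - K + 1) fun x _ y _ hxy => by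
          simp only at hxy; linarith))
      rintro _ ⟨x, hx, rfl⟩
      exact hroot x hx
    exact (mul_eq_zero.1 hinf).resolve_right (pow_ne_zero _ X_ne_zero)
  have h0 : G.eval 0 = 0 := by rw [hG0, eval_zero]
  simp only [hG, hW, hc, hk, eval_add, eval_mul, eval_sub, eval_pow, eval_X, eval_C, eval_comp,
    eval_neg, eval_ofNat, zero_pow (show s - i ≠ 0 by omega), zero_mul, neg_zero, mul_zero,
    zero_add, zero_sub, add_zero] at h0
  -- The two polar contributions at `t = 0` do not cancel, since `K ≥ 2` and `i ≥ 1`.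
  have hne : (-(2 * (K : ℝ))) ^ i - (-2) ^ i ≠ 0 := by
    have : (-(2 * (K : ℝ))) ^ i - (-2) ^ i = (-2) ^ i * ((K : ℝ) ^ i - 1) := by
      rw [show -(2 * (K : ℝ)) = (-2) * K by ring, mul_pow]; ring
    rw [this]
    have h1 : 1 < (K : ℝ) ^ i := one_lt_pow₀ (by linarith) (by omega)
    exact mul_ne_zero (pow_ne_zero _ (by norm_num)) (by linarith)
  have hpi : (Real.pi ^ 2) ^ i ≠ 0 := by positivity
  have w1 : (-2 : ℝ) ^ s ≠ 0 := pow_ne_zero _ (by norm_num)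
  have w2 : (2 * (K : ℝ) - 2) ^ s ≠ 0 := pow_ne_zero _ (by linarith)
  have w3 : (2 * (K : ℝ)) ^ s ≠ 0 := pow_ne_zero _ (by linarith)
  have : (Real.pi ^ 2) ^ i * ((-(2 * (K : ℝ))) ^ i - (-2) ^ i) * ρ.eval 0 *
      ((-2) ^ s * (2 * (K : ℝ) - 2) ^ s * (2 * (K : ℝ)) ^ s) = 0 :=
    Eq.trans (by ring) h0
  exact mul_ne_zero (mul_ne_zero (mul_ne_zero hpi hne) hρ0)
    (mul_ne_zero (mul_ne_zero w1 w2) w3) this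

/-- The symbols at the large multiples of `M` span the linear forms on the polynomials of degree
at most `n` that vanish at the constants. -/
lemma exists_finsupp_sum_bracketSymbol {K n s : ℕ} (hK : 2 ≤ K) (hns : n < s) {M : ℕ}
    (hM : 0 < M) (N : ℕ) (L : ℝ[X] →ₗ[ℝ] ℝ) (hL : L 1 = 0) :
    ∃ a : ℕ →₀ ℝ, (∀ e ∈ a.support, M ∣ e ∧ N ≤ e) ∧
      ∀ α : ℝ[X], α.natDegree ≤ n → (a.sum fun e c => c * bracketSymbol α K s e) = L α := by
  set E := degreeLT ℝ (n + 1)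
  let ι := {e : ℕ // (M ∣ e ∧ N ≤ e) ∧ K + 1 < e}
  -- In finite dimension, a form that vanishes on the common kernel of a family lies in its span.
  -- Here the common kernel contains only constants, by the pole argument.
  have hker : ⨅ e : ι, LinearMap.ker ((bracketSymbolLin K s (e : ℕ)).domRestrict E)
      ≤ LinearMap.ker (L.domRestrict E) := by
    intro α hα
    rw [Submodule.mem_iInf] at hα
    have hdeg : (α : ℝ[X]).natDegree ≤ n := by
      by_cases h0 : (α : ℝ[X]) = 0
      · simp [h0]
      · exact Nat.lt_succ_iff.1 ((natDegree_lt_iff_degree_lt h0).2 (mem_degreeLT.1 α.2))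
    have h0 : (α : ℝ[X]).natDegree = 0 := by
      refine natDegree_eq_zero_of_bracketSymbol (K := K) (s := s) hK (by omega)
        (T := Set.range fun i : ℕ => ((M * (i + N + K + 2) : ℕ) : ℝ)) ?_ ?_
      · refine Set.infinite_range_of_injective fun i j hij => ?_
        have := Nat.eq_of_mul_eq_mul_left hM (Nat.cast_injective hij)
        omega
      · rintro _ ⟨i, rfl⟩
        have hle : i + N + K + 2 ≤ M * (i + N + K + 2) := Nat.le_mul_of_pos_left _ hM
        refine ⟨?_, ?_⟩
        · have : K + 1 < M * (i + N + K + 2) := by omega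
          simp only
          exact_mod_cast this
        exact hα ⟨M * (i + N + K + 2), ⟨dvd_mul_right _ _, by omega⟩, by omega⟩
    rw [LinearMap.mem_ker, LinearMap.domRestrict_apply, eq_C_of_natDegree_eq_zero h0,
      ← mul_one (C _), ← smul_eq_C_mul, map_smul, hL, smul_zero]
  have hfin : FiniteDimensional ℝ E := inferInstance
  obtain ⟨c, hc⟩ := (Finsupp.mem_span_range_iff_exists_finsupp).1
    (FiniteDimensional.mem_span_of_iInf_ker_le_ker hker)
  refine ⟨c.embDomain (Function.Embedding.subtype _), fun e he => ?_, fun α hα => ?_⟩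
  · rw [Finsupp.support_embDomain, Finset.mem_map] at he
    obtain ⟨i, -, rfl⟩ := he
    exact i.2.1
  · have hmem : α ∈ E := mem_degreeLT.2
      ((degree_le_of_natDegree_le hα).trans_lt (by exact_mod_cast Nat.lt_succ_self n))
    have := LinearMap.congr_fun hc ⟨α, hmem⟩
    rw [LinearMap.domRestrict_apply] at this
    rw [← this, Finsupp.sum_embDomain, Finsupp.sum, Finsupp.sum, LinearMap.sum_apply]
    rfl

/-! ### Brackets with finitely supported sequences -/

/-- A cosine of frequency `e > i` couples mode `i` only to the modes `e ± i`, so bracket sums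
against it are finite. -/
lemma cosMat_single {e i : ℕ} (hi : i < e) (j : ℕ) :
    cosMat (Pi.single e 1) i j
      = (if j = e + i then 1 else 0) - (if j = e - i then 1 else 0) := by
  simp only [cosMat, Pi.single_apply]
  congr 1 <;> congr 1 <;> rw [eq_iff_iff] <;> omega

lemma hasSum_mul_cosMat_single {e i : ℕ} (hi : i < e) (F : ℕ → ℝ) :
    HasSum (fun j => F j * cosMat (Pi.single e 1) i j) (F (e + i) - F (e - i)) := by
  have h := (hasSum_ite_eq (e + i) (F (e + i))).sub (hasSum_ite_eq (e - i) (F (e - i)))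
  have hF : (fun j => F j * cosMat (Pi.single e 1) i j) = fun j =>
      (if j = e + i then F (e + i) else 0) - (if j = e - i then F (e - i) else 0) := by
    ext j
    rw [cosMat_single hi, mul_sub, mul_ite, mul_ite, mul_one, mul_zero]
    congr 1 <;> split_ifs with hj <;> simp [hj]
  rw [hF]
  exact h

lemma cosMat_finsupp (a : ℕ →₀ ℝ) (i j : ℕ) :
    cosMat a i j = a.sum fun e c => c * cosMat (Pi.single e 1) i j := by
  have h : ∀ k, a k = a.sum fun e c => c * (Pi.single e 1 : ℕ → ℝ) k := fun k => by
    simp [Finsupp.sum, Pi.single_apply]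
  rw [cosMat, h, h, Finsupp.sum, Finsupp.sum, Finsupp.sum, ← Finset.sum_sub_distrib]
  simp only [cosMat, mul_sub]

lemma bracketTerm_finsupp (α : ℝ[X]) (K : ℕ) (m : ℕ → ℝ) (a : ℕ →₀ ℝ) (j : ℕ) :
    bracketTerm α K m a j = a.sum fun e c => c * bracketTerm α K m (Pi.single e 1) j := by
  simp only [bracketTerm, cosMat_finsupp a, Finsupp.sum, Finset.sum_mul, Finset.mul_sum,
    ← Finset.sum_sub_distrib]
  exact Finset.sum_congr rfl fun e _ => by ring

/-- Only `j = e ± 1` and `j = e ± K` contribute. The smallest frequency of `m` then met is `e - 1 -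
K ≥ N₀`, so the explicit tail applies throughout. -/
lemma hasSum_bracketTerm_single {m : ℕ → ℝ} {s N₀ : ℕ}
    (hm : ∀ k ≥ N₀, m k = 1 / (k : ℝ) ^ s) (α : ℝ[X]) {K e : ℕ} (hK : 2 ≤ K)
    (he : N₀ + K + 1 ≤ e) :
    HasSum (bracketTerm α K m (Pi.single e 1)) (bracketSymbol α K s e) := by
  have h1 := hasSum_mul_cosMat_single (e := e) (i := 1) (by omega)
    (fun j => α.eval (eigval K - eigval j) * cosMat m j K)
  have h2 := hasSum_mul_cosMat_single (e := e) (i := K) (by omega)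
    (fun j => α.eval (eigval j - eigval 1) * cosMat m 1 j)
  have hterm : bracketTerm α K m (Pi.single e 1) = fun j =>
      α.eval (eigval K - eigval j) * cosMat m j K * cosMat (Pi.single e 1) 1 j
        - α.eval (eigval j - eigval 1) * cosMat m 1 j * cosMat (Pi.single e 1) K j := by
    ext j
    simp only [bracketTerm, cosMat_comm _ K j]
    ring
  rw [hterm]
  have c1 : ((e - 1 : ℕ) : ℝ) = e - 1 := Nat.cast_pred (by omega)
  have c2 : ((e - K : ℕ) : ℝ) = e - K := Nat.cast_sub (by omega)
  have d1 : cosMat m (e + 1) K = 1 / ((e : ℝ) + 1 - K) ^ s - 1 / ((e : ℝ) + 1 + K) ^ s := by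
    rw [cosMat, hm _ (by omega), hm _ (by omega), show K - (e + 1) = 0 by omega,
      add_zero, Nat.cast_sub (by omega)]
    push_cast; ring
  have d2 : cosMat m (e - 1) K = 1 / ((e : ℝ) - 1 - K) ^ s - 1 / ((e : ℝ) - 1 + K) ^ s := by
    rw [cosMat, hm _ (by omega), hm _ (by omega), show K - (e - 1) = 0 by omega,
      add_zero, Nat.cast_sub (by omega)]
    push_cast [c1]; ring
  have d3 : cosMat m 1 (e + K) = 1 / ((e : ℝ) + K - 1) ^ s - 1 / ((e : ℝ) + K + 1) ^ s := by
    rw [cosMat, hm _ (by omega), hm _ (by omega), show 1 - (e + K) = 0 by omega,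
      zero_add, Nat.cast_sub (by omega)]
    push_cast; ring
  have d4 : cosMat m 1 (e - K) = 1 / ((e : ℝ) - K - 1) ^ s - 1 / ((e : ℝ) - K + 1) ^ s := by
    rw [cosMat, hm _ (by omega), hm _ (by omega), show 1 - (e - K) = 0 by omega,
      zero_add, Nat.cast_sub (by omega), Nat.cast_add, c2]
    push_cast; ring
  have hv : bracketSymbol α K s e
      = (α.eval (eigval K - eigval (e + 1)) * cosMat m (e + 1) K
          - α.eval (eigval K - eigval (e - 1)) * cosMat m (e - 1) K)
        - (α.eval (eigval (e + K) - eigval 1) * cosMat m 1 (e + K)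
          - α.eval (eigval (e - K) - eigval 1) * cosMat m 1 (e - K)) := by
    rw [d1, d2, d3, d4, bracketSymbol]
    simp only [eigval, c1, c2, Nat.cast_add, Nat.cast_one]
  rw [hv]
  exact h1.sub h2

lemma hasSum_bracketTerm_finsupp {m : ℕ → ℝ} {s N₀ : ℕ}
    (hm : ∀ k ≥ N₀, m k = 1 / (k : ℝ) ^ s) (α : ℝ[X]) {K : ℕ} (hK : 2 ≤ K) (a : ℕ →₀ ℝ)
    (ha : ∀ e ∈ a.support, N₀ + K + 1 ≤ e) :
    HasSum (bracketTerm α K m a) (a.sum fun e c => c * bracketSymbol α K s e) := by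
  rw [funext (bracketTerm_finsupp α K m a)]
  exact hasSum_sum fun e he => (hasSum_bracketTerm_single hm α hK (ha e he)).mul_left _

/-- Every linear form on the polynomials of degree at most `n` that vanishes at the constants is
the sum of the bracket series with a finitely supported sequence, whose support may be taken in
the large multiples of `M`. -/
lemma exists_finsupp_hasSum_bracketTerm {K n s : ℕ} (hK : 2 ≤ K) (hns : n < s) {M : ℕ}
    (hM : 0 < M) {m : ℕ → ℝ} {N₀ : ℕ} (hm : ∀ k ≥ N₀, m k = 1 / (k : ℝ) ^ s) (N : ℕ)
    (L : ℝ[X] →ₗ[ℝ] ℝ) (hL : L 1 = 0) :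
    ∃ a : ℕ →₀ ℝ, (∀ e, a e ≠ 0 → M ∣ e ∧ N ≤ e) ∧
      ∀ α : ℝ[X], α.natDegree ≤ n → HasSum (bracketTerm α K m a) (L α) := by
  obtain ⟨a, ha, haL⟩ := exists_finsupp_sum_bracketSymbol hK hns hM (N + (N₀ + K + 1)) L hL
  refine ⟨a, fun e he => ?_, fun α hα => ?_⟩
  · have := ha e (Finsupp.mem_support_iff.2 he)
    exact ⟨this.1, by omega⟩
  · rw [← haL α hα]
    exact hasSum_bracketTerm_finsupp hm α hK a fun e he => by have := (ha e he).2; omega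

lemma dvd_of_cosMat_ne_zero {a : ℕ → ℝ} {M : ℕ} (ha : ∀ e, a e ≠ 0 → M ∣ e) {i j : ℕ}
    (h : cosMat a i j ≠ 0) : (M : ℤ) ∣ j - i ∨ (M : ℤ) ∣ j + i := by
  by_contra! hc
  have h1 : a (i - j + (j - i)) = 0 := by
    by_contra h1
    have h2 := Int.natCast_dvd_natCast.2 (ha _ h1)
    rcases le_total i j with hij | hij
    · rw [Nat.sub_eq_zero_of_le hij, zero_add, Nat.cast_sub hij] at h2
      exact hc.1 h2
    · rw [Nat.sub_eq_zero_of_le hij, add_zero, Nat.cast_sub hij, ← dvd_neg, neg_sub] at h2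
      exact hc.1 h2
  have h2 : a (i + j) = 0 := by
    by_contra h1
    have h2 := Int.natCast_dvd_natCast.2 (ha _ h1)
    rw [add_comm, Nat.cast_add] at h2
    exact hc.2 h2
  exact h (by rw [cosMat, h1, h2, sub_zero])

/-- Sequences supported in the multiples of `2K + 2` have vanishing quadratic coefficients. -/
lemma cosMat_mul_cosMat_eq_zero {K : ℕ} (hK : 2 ≤ K) {a b : ℕ → ℝ}
    (ha : ∀ e, a e ≠ 0 → (2 * K + 2) ∣ e) (hb : ∀ e, b e ≠ 0 → (2 * K + 2) ∣ e) (j : ℕ) :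
    cosMat a 1 j * cosMat b j K = 0 := by
  by_contra h
  obtain ⟨h1, h2⟩ := mul_ne_zero_iff.1 h
  rw [cosMat_comm] at h2
  have h1' := dvd_of_cosMat_ne_zero ha h1
  have h2' := dvd_of_cosMat_ne_zero hb h2
  push_cast at h1' h2'
  have hlt : ∀ x : ℤ, 0 < x → x < 2 * K + 2 → ¬ ((2 * K + 2 : ℤ) ∣ x) := fun x hx hx' hd =>
    absurd (Int.le_of_dvd hx hd) (by omega)
  -- A nonzero product forces `j ≡ ±1` and `j ≡ ±K` modulo `2K + 2`, hence `2K + 2` divides `K - 1`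
  -- or `K + 1`, which is impossible by size.
  rcases h1' with h1 | h1 <;> rcases h2' with h2 | h2
  · exact hlt (K - 1) (by omega) (by omega)
      (by rw [show ((K - 1 : ℤ)) = j - 1 - (j - K) by ring]; exact dvd_sub h1 h2)
  · exact hlt (K + 1) (by omega) (by omega)
      (by rw [show ((K + 1 : ℤ)) = j + K - (j - 1) by ring]; exact dvd_sub h2 h1)
  · exact hlt (K + 1) (by omega) (by omega)
      (by rw [show ((K + 1 : ℤ)) = j + 1 - (j - K) by ring]; exact dvd_sub h1 h2)
  · exact hlt (K - 1) (by omega) (by omega)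
      (by rw [show ((K - 1 : ℤ)) = j + K - (j + 1) by ring]; exact dvd_sub h2 h1)

/-! ### Summability of the bracket series -/

/-- The sum is linear in `α` only where the series converge; defining the form through the
coefficients of degree at most `n` makes it linear on all of `ℝ[X]`. -/
lemma exists_linearMap_hasSum (n : ℕ) (g : ℝ[X] →ₗ[ℝ] (ℕ → ℝ))
    (hg : ∀ α : ℝ[X], α.natDegree ≤ n → Summable (g α)) :
    ∃ L : ℝ[X] →ₗ[ℝ] ℝ, ∀ α : ℝ[X], α.natDegree ≤ n → HasSum (g α) (L α) := by
  refine ⟨∑ i ∈ Finset.range (n + 1), (∑' j, g (X ^ i) j) • lcoeff ℝ i, fun α hα => ?_⟩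
  have h1 : g α = fun j => ∑ i ∈ Finset.range (n + 1), α.coeff i * g (X ^ i) j := by
    ext j
    conv_lhs => rw [α.as_sum_range' (n + 1) (by omega)]
    simp only [← C_mul_X_pow_eq_monomial, ← smul_eq_C_mul, map_sum, map_smul, Finset.sum_apply,
      Pi.smul_apply, smul_eq_mul]
  rw [h1]
  simp only [LinearMap.sum_apply, LinearMap.smul_apply, lcoeff_apply, smul_eq_mul]
  refine hasSum_sum fun i hi => ?_
  rw [mul_comm]
  refine (hg (X ^ i) ?_).hasSum.mul_left _
  rw [natDegree_X_pow]
  simpa [Nat.lt_succ_iff] using hi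

open Asymptotics Filter in
lemma isBigO_cosMat {m : ℕ → ℝ} {s N₀ : ℕ} (hm : ∀ k ≥ N₀, m k = 1 / (k : ℝ) ^ s) (i : ℕ) :
    (fun j => cosMat m i j) =O[atTop] fun j : ℕ => 1 / (j : ℝ) ^ s := by
  refine IsBigO.of_bound (2 ^ s + 1) ?_
  filter_upwards [eventually_ge_atTop (N₀ + 2 * i + 1)] with j hj
  have hj0 : (0 : ℝ) < j := by exact_mod_cast (show 0 < j by omega)
  have hij : (j : ℝ) / 2 ≤ (j : ℝ) - i := by
    have : (2 * i : ℝ) ≤ j := by exact_mod_cast (show 2 * i ≤ j by omega)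
    linarith
  rw [cosMat, hm _ (by omega), hm _ (by omega), Nat.sub_eq_zero_of_le (show i ≤ j by omega),
    zero_add, Nat.cast_sub (by omega)]
  refine (norm_sub_le _ _).trans ?_
  rw [add_mul, one_mul]
  have hpos : (0 : ℝ) < j - i := by linarith
  gcongr
  · rw [Real.norm_of_nonneg (by positivity), Real.norm_of_nonneg (by positivity)]
    calc 1 / ((j : ℝ) - i) ^ s ≤ 1 / ((j : ℝ) / 2) ^ s := by gcongr
      _ = 2 ^ s * (1 / (j : ℝ) ^ s) := by rw [div_pow]; field_simp
  · rw [Real.norm_of_nonneg (by positivity), Real.norm_of_nonneg (by positivity)]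
    gcongr
    linarith [(Nat.cast_nonneg i : (0 : ℝ) ≤ i)]

open Asymptotics Filter in
lemma isBigO_eval_natCast {β : ℝ[X]} {d : ℕ} (hβ : β.natDegree ≤ d) :
    (fun j : ℕ => β.eval (j : ℝ)) =O[atTop] fun j : ℕ => (j : ℝ) ^ d := by
  have h := (isBigO_atTop_of_degree_le (P := β) (Q := X ^ d) (by
    rw [degree_X_pow]; exact degree_le_of_natDegree_le hβ)).comp_tendsto
      (tendsto_natCast_atTop_atTop (R := ℝ))
  refine h.congr_right fun j => by simp

open Asymptotics Filter in
-- The polynomial factor is `O(j ^ (2n))` and each matrix element is `O(j ^ (-s))`; `n < s` leaves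
-- `O(j ^ (-2))`.
lemma summable_bracketTerm {m m' : ℕ → ℝ} {s n N₀ : ℕ} (hns : n < s)
    (hm : ∀ k ≥ N₀, m k = 1 / (k : ℝ) ^ s) (hm' : ∀ k ≥ N₀, m' k = 1 / (k : ℝ) ^ s)
    {α : ℝ[X]} (hα : α.natDegree ≤ n) (K : ℕ) : Summable (bracketTerm α K m m') := by
  have h2 : Summable fun j : ℕ => 1 / (j : ℝ) ^ 2 := by
    exact Real.summable_one_div_nat_pow.2 one_lt_two
  have hpow : (fun j : ℕ => (j : ℝ) ^ (2 * n) * (1 / (j : ℝ) ^ s * (1 / (j : ℝ) ^ s)))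
      =O[atTop] fun j : ℕ => 1 / (j : ℝ) ^ 2 := by
    refine IsBigO.of_bound 1 ?_
    filter_upwards [eventually_ge_atTop 1] with j hj
    have hj1 : (1 : ℝ) ≤ j := by exact_mod_cast hj
    rw [Real.norm_of_nonneg (by positivity), Real.norm_of_nonneg (by positivity), one_mul,
      one_div_mul_one_div, mul_one_div, ← pow_add, div_le_div_iff₀ (by positivity) (by positivity),
      ← pow_add, one_mul]
    exact pow_le_pow_right₀ hj1 (by omega)
  have key : ∀ (β : ℝ[X]) (r r' : ℕ → ℝ) (i i' : ℕ), β.natDegree ≤ 2 * n →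
      (∀ k ≥ N₀, r k = 1 / (k : ℝ) ^ s) → (∀ k ≥ N₀, r' k = 1 / (k : ℝ) ^ s) →
      Summable fun j : ℕ => β.eval (j : ℝ) * (cosMat r i j * cosMat r' i' j) := by
    intro β r r' i i' hβ hr hr'
    exact summable_of_isBigO_nat h2 (((isBigO_eval_natCast hβ).mul
      ((isBigO_cosMat hr i).mul (isBigO_cosMat hr' i'))).trans hpow)
  have hdeg : ∀ a b : ℝ, (α.comp (C a + C b * X ^ 2)).natDegree ≤ 2 * n := fun a b => by
    refine natDegree_comp_le.trans ?_
    have : (C a + C b * X ^ 2 : ℝ[X]).natDegree ≤ 2 := by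
      compute_degree
    nlinarith
  have s1 := key (α.comp (C (eigval K) + C (-Real.pi ^ 2) * X ^ 2)) m' m 1 K (hdeg _ _) hm' hm
  have s2 := key (α.comp (C (-eigval 1) + C (Real.pi ^ 2) * X ^ 2)) m m' 1 K (hdeg _ _) hm hm'
  refine (s1.sub s2).congr fun j => ?_
  simp only [bracketTerm, eval_comp, eval_add, eval_mul, eval_C, eval_pow, eval_X,
    cosMat_comm _ K j]
  have e1 : eigval K + -Real.pi ^ 2 * (j : ℝ) ^ 2 = eigval K - eigval j := by
    simp only [eigval]; ring
  have e2 : -eigval 1 + Real.pi ^ 2 * (j : ℝ) ^ 2 = eigval j - eigval 1 := by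
    simp only [eigval]; ring
  rw [e1, e2]

/-! ### The sequences of cosine coefficients of the two dipolar moments -/

lemma exists_base_sequence {K : ℕ} (hK : 2 ≤ K) {s : ℕ} (hs : s ≠ 0) :
    ∃ v : ℕ → ℝ, (∀ k ≥ K, v k = 1 / (k : ℝ) ^ s) ∧ cosMat v 1 K = 0 ∧
      ∀ j, 1 ≤ j → j ≠ K → cosMat v 1 j ≠ 0 := by
  -- Changing the value at `K - 1` to the one at `K + 1` gives `cosMat v 1 K = 0`. The value `2` at
  -- `0` exceeds all the others, so `v (j - 1) - v (j + 1)` stays positive for every other `j`.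
  let v : ℕ → ℝ := fun k =>
    if k = 0 then 2 else if k = K - 1 then 1 / ((K + 1 : ℕ) : ℝ) ^ s else 1 / (k : ℝ) ^ s
  have hv : ∀ k, k ≠ 0 → k ≠ K - 1 → v k = 1 / (k : ℝ) ^ s := fun k h1 h2 => by simp [v, h1, h2]
  have hvK : v (K - 1) = 1 / ((K + 1 : ℕ) : ℝ) ^ s := by simp [v, show K - 1 ≠ 0 by omega]
  have hlt : ∀ k l : ℕ, 0 < k → k < l → 1 / (l : ℝ) ^ s < 1 / (k : ℝ) ^ s := fun k l hk hl => by
    have : (0 : ℝ) < k := by exact_mod_cast hk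
    gcongr
  refine ⟨v, fun k hk => hv k (by omega) (by omega), ?_, fun j hj hjK => ?_⟩
  · rw [cosMat, show 1 - K + (K - 1) = K - 1 by omega, hvK, hv (1 + K) (by omega) (by omega),
      add_comm 1 K, sub_self]
  · rw [cosMat, show 1 - j + (j - 1) = j - 1 by omega]
    refine (sub_pos.2 ?_).ne'
    obtain ⟨l, hl1, hl2⟩ : ∃ l : ℕ, 1 + j ≤ l ∧ v (1 + j) = 1 / (l : ℝ) ^ s := by
      by_cases h : 1 + j = K - 1
      · exact ⟨K + 1, by omega, by rw [h, hvK]⟩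
      · exact ⟨1 + j, le_rfl, hv _ (by omega) h⟩
    rw [hl2]
    by_cases h0 : j - 1 = 0
    · have h1 := hlt 1 l one_pos (by omega)
      have : v (j - 1) = 2 := by simp [v, h0]
      rw [this]
      simp only [Nat.cast_one, one_pow, div_one] at h1 ⊢
      linarith
    · rw [hv _ h0 (by omega)]
      exact hlt _ _ (by omega) (by omega)

lemma cosMat_one_eq_zero_of_support {a : ℕ → ℝ} {K : ℕ} (ha : ∀ e, a e ≠ 0 → K + 2 ≤ e) :
    cosMat a 1 K = 0 := by
  have h : ∀ e < K + 2, a e = 0 := fun e he => by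
    by_contra h; have := ha e h; omega
  rw [cosMat, h _ (by omega), h _ (by omega), sub_zero]

lemma exists_ne_zero_of_cosMat_one_ne_zero {a : ℕ → ℝ} {j : ℕ} (h : cosMat a 1 j ≠ 0) :
    ∃ e, a e ≠ 0 ∧ e ≤ j + 1 ∧ j ≤ e + 1 := by
  by_contra! hc
  have h1 : a (1 - j + (j - 1)) = 0 := by
    by_contra h1; have := hc _ h1 (by omega); omega
  have h2 : a (1 + j) = 0 := by
    by_contra h1; have := hc _ h1 (by omega); omega
  exact h (by rw [cosMat, h1, h2, sub_zero])

/-- Each factor, if nonzero, puts a support point within distance `1` of `j`, while distinct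
multiples of `M ≥ 3` are more than `2` apart. -/
lemma cosMat_one_mul_cosMat_one_eq_zero {a b : ℕ → ℝ} {M : ℕ} (hM : 3 ≤ M)
    (ha : ∀ e, a e ≠ 0 → M ∣ e) (hb : ∀ e, b e ≠ 0 → M ∣ e)
    (hab : ∀ e e', a e ≠ 0 → b e' ≠ 0 → e < e') (j : ℕ) :
    cosMat a 1 j * cosMat b 1 j = 0 := by
  by_contra h
  obtain ⟨h1, h2⟩ := mul_ne_zero_iff.1 h
  obtain ⟨e, he, he1, he2⟩ := exists_ne_zero_of_cosMat_one_ne_zero h1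
  obtain ⟨e', he', he1', he2'⟩ := exists_ne_zero_of_cosMat_one_ne_zero h2
  have hlt := hab e e' he he'
  have := Nat.le_of_dvd (by omega) (Nat.dvd_sub (hb e' he') (ha e he))
  omega

/-- An affine path avoiding countably many hyperplanes. -/
lemma exists_forall_affine_ne_zero {P : ℕ → Prop} (u p q : ℕ → ℝ) (hu : ∀ j, P j → u j ≠ 0)
    (hpq : ∀ j, p j * q j = 0) :
    ∃ θ : ℝ, ∀ j, P j → u j + (θ * p j + (1 - θ) * q j) ≠ 0 := by
  have hcount : (⋃ j : {j // P j}, {θ : ℝ | u j + (θ * p j + (1 - θ) * q j) = 0}).Countable := by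
    -- Each `j` excludes at most one `θ`: two zeros would force `p j = q j`, hence both zero, and
    -- then `u j = 0`.
    refine Set.countable_iUnion fun j => Set.Subsingleton.countable fun θ hθ θ' hθ' => ?_
    simp only [Set.mem_ofPred_eq] at hθ hθ'
    by_contra hne
    have h1 : (θ - θ') * (p j - q j) = 0 := by linear_combination hθ - hθ'
    have h2 : p j = q j := by
      have := (mul_eq_zero.1 h1).resolve_left (sub_ne_zero.2 hne)
      linarith
    have h3 : q j = 0 := by have := hpq j; rw [h2] at this; simpa using this
    rw [h2, h3] at hθ
    exact hu j j.2 (by simpa using hθ)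
  obtain ⟨θ, hθ⟩ : ∃ θ, θ ∉ ⋃ j : {j // P j}, {θ : ℝ | u j + (θ * p j + (1 - θ) * q j) = 0} := by
    by_contra! hall
    exact Set.not_countable_univ (hcount.mono fun θ _ => hall θ)
  exact ⟨θ, fun j hj h => hθ (Set.mem_iUnion.2 ⟨⟨j, hj⟩, h⟩)⟩

/-- Expansion of an antisymmetric bracket around `v`, the perturbation having no quadratic
contribution. -/
lemma bracketTerm_add_self {σ : ℝ[X]} {K : ℕ}
    (hσ : ∀ x, σ.eval (eigval K - eigval 1 - x) = -σ.eval x) (v a a' : ℕ → ℝ) (θ : ℝ) (j : ℕ)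
    (h0 : cosMat (fun k => θ * a k + (1 - θ) * a' k) 1 j
      * cosMat (fun k => θ * a k + (1 - θ) * a' k) j K = 0) :
    bracketTerm σ K (fun k => v k + (θ * a k + (1 - θ) * a' k))
        (fun k => v k + (θ * a k + (1 - θ) * a' k)) j
      = bracketTerm σ K v v j
        + 2 * (θ * bracketTerm σ K v a j + (1 - θ) * bracketTerm σ K v a' j) := by
  -- Antisymmetry turns the minus sign of the bracket into a plus, making it symmetric in its two
  -- sequences; hence the factor `2` on the cross terms.
  have hY : σ.eval (eigval j - eigval 1) = -σ.eval (eigval K - eigval j) := by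
    rw [← hσ]; congr 1; ring
  simp only [bracketTerm, hY]
  simp only [cosMat] at h0 ⊢
  linear_combination 2 * σ.eval (eigval K - eigval j) * h0

/-- The sequence of cosine coefficients of the first dipolar moment. -/
lemma exists_first_sequence {K n s : ℕ} (hK : 2 ≤ K) (hns : n < s) :
    ∃ (m : ℕ → ℝ) (N : ℕ), (∀ k ≥ N, m k = 1 / (k : ℝ) ^ s) ∧ cosMat m 1 K = 0 ∧
      (∀ j, 1 ≤ j → j ≠ K → cosMat m 1 j ≠ 0) ∧
      ∀ σ : ℝ[X], σ.natDegree ≤ n → (∀ x, σ.eval (eigval K - eigval 1 - x) = -σ.eval x) →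
        HasSum (bracketTerm σ K m m) 0 := by
  obtain ⟨v, hv, hvK, hvj⟩ := exists_base_sequence hK (s := s) (by omega)
  obtain ⟨L, hL⟩ := exists_linearMap_hasSum n (bracketTermLin K v v) fun α hα =>
    summable_bracketTerm hns hv hv hα K
  have hL1 : L 1 = 0 := by
    have h := hL 1 (by simp)
    rw [show bracketTermLin K v v 1 = 0 from bracketTerm_one K v] at h
    exact h.unique hasSum_zero
  -- The factor `-1/2` compensates the doubled cross term.
  have hL1' : (-(1 / 2 : ℝ) • L) 1 = 0 := by simp [hL1]
  obtain ⟨a, ha, haL⟩ := exists_finsupp_hasSum_bracketTerm hK hns (M := 2 * K + 2) (by omega) hv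
    (K + 2) _ hL1'
  -- A second solution, supported beyond the first. Every `θ a + (1 - θ) a'` is again a solution,
  -- and for each `j` at most one of the two moves `cosMat v 1 j`, so some `θ` avoids every
  -- cancellation.
  obtain ⟨a', ha', haL'⟩ := exists_finsupp_hasSum_bracketTerm hK hns (M := 2 * K + 2) (by omega) hv
    (K + 2 + a.support.sup id) _ hL1'
  have hsup : ∀ e, a e ≠ 0 → e ≤ a.support.sup id := fun e he =>
    Finset.le_sup (f := id) (Finsupp.mem_support_iff.2 he)
  obtain ⟨θ, hθ⟩ := exists_forall_affine_ne_zero (P := fun j => 1 ≤ j ∧ j ≠ K)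
    (fun j => cosMat v 1 j) (fun j => cosMat a 1 j) (fun j => cosMat a' 1 j)
    (fun j hj => hvj j hj.1 hj.2)
    (cosMat_one_mul_cosMat_one_eq_zero (M := 2 * K + 2) (by omega) (fun e he => (ha e he).1)
      (fun e he => (ha' e he).1) fun e e' he he' => by
        have := hsup e he; have := (ha' e' he').2; omega)
  have hcos : ∀ i j, cosMat (fun k => v k + (θ * a k + (1 - θ) * a' k)) i j
      = cosMat v i j + (θ * cosMat a i j + (1 - θ) * cosMat a' i j) := fun i j => by
    simp only [cosMat]; ring
  refine ⟨fun k => v k + (θ * a k + (1 - θ) * a' k),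
    K + a.support.sup id + a'.support.sup id + 1, fun k hk => ?_, ?_, fun j hj hjK => ?_,
    fun σ hσ hanti => ?_⟩
  · have h1 : a k = 0 := by
      by_contra h; have := hsup k h; omega
    have h2 : a' k = 0 := by
      by_contra h
      have : k ≤ a'.support.sup id := Finset.le_sup (f := id) (Finsupp.mem_support_iff.2 h)
      omega
    simp only [h1, h2]
    rw [hv k (by omega)]; ring
  · rw [hcos, hvK, cosMat_one_eq_zero_of_support fun e he => (ha e he).2,
      cosMat_one_eq_zero_of_support fun e he => by have := (ha' e he).2; omega]
    ring
  · rw [hcos]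
    exact hθ j ⟨hj, hjK⟩
  · have hdvd : ∀ e, θ * a e + (1 - θ) * a' e ≠ 0 → (2 * K + 2) ∣ e := fun e he => by
      by_contra hd
      have h1 : a e = 0 := by by_contra h; exact hd (ha e h).1
      have h2 : a' e = 0 := by by_contra h; exact hd (ha' e h).1
      exact he (by rw [h1, h2]; ring)
    have hsum := (hL σ hσ).add
      ((((haL σ hσ).mul_left θ).add ((haL' σ hσ).mul_left (1 - θ))).mul_left 2)
    have hzero : L σ + 2 * (θ * (-(1 / 2 : ℝ) • L) σ + (1 - θ) * (-(1 / 2 : ℝ) • L) σ) = 0 := by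
      simp only [LinearMap.smul_apply, smul_eq_mul]; ring
    rw [hzero] at hsum
    rw [funext fun j => bracketTerm_add_self hanti v a a' θ j
      (cosMat_mul_cosMat_eq_zero hK hdvd hdvd j)]
    exact hsum

/-! ### From sequences to dipolar moments -/

/-- The series of the statement start at `j = 1`; the term `j = 0` vanishes because `φ_0 = 0`. -/
lemma hasSum_bracketTerm_succ {α : ℝ[X]} {K : ℕ} {m m' : ℕ → ℝ} {S : ℝ}
    (h : HasSum (bracketTerm α K m m') S) :
    HasSum (fun j => bracketTerm α K m m' (j + 1)) S := by
  have := (hasSum_nat_add_iff' 1).2 h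
  simpa [bracketTerm, cosMat] using this

/-! ### The polynomials attached to `A_k` and `γ_k` -/

/-- The polynomial of the series `A_{l+1}`. -/
noncomputable def polyA (K l : ℕ) : ℝ[X] :=
  (C (eigval K - eigval 1) - 2 * X) * X ^ l * (C (eigval K - eigval 1) - X) ^ l

/-- The polynomial of the series `γ_k`. -/
noncomputable def polyGamma (K k : ℕ) : ℝ[X] :=
  X ^ ((k + 1) / 2) * (C (eigval K - eigval 1) - X) ^ (k / 2)

lemma natDegree_polyA_le (K l : ℕ) : (polyA K l).natDegree ≤ 2 * l + 1 := by
  have h1 : (C (eigval K - eigval 1) - 2 * X : ℝ[X]).natDegree ≤ 1 := by compute_degree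
  have h2 : ((C (eigval K - eigval 1) - X : ℝ[X]) ^ l).natDegree ≤ l * 1 :=
    natDegree_pow_le_of_le l (by compute_degree)
  have h3 : (X ^ l : ℝ[X]).natDegree ≤ l := natDegree_X_pow_le l
  have := natDegree_mul_le_of_le (natDegree_mul_le_of_le h1 h3) h2
  exact this.trans (by omega)

lemma polyA_antisymm (K l : ℕ) (x : ℝ) :
    (polyA K l).eval (eigval K - eigval 1 - x) = -(polyA K l).eval x := by
  simp only [polyA, eval_mul, eval_sub, eval_C, eval_X, eval_pow, eval_ofNat, sub_sub_cancel]
  ring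

lemma natDegree_C_sub_X_pow (c : ℝ) (k : ℕ) :
    ((C c - X : ℝ[X]) ^ k).natDegree = k ∧ ((C c - X : ℝ[X]) ^ k).leadingCoeff = (-1) ^ k := by
  have h : (C c - X : ℝ[X]) = -(X - C c) := by ring
  rw [h, neg_pow, ← C_1, ← C_neg, ← C_pow, natDegree_C_mul (pow_ne_zero _ (by norm_num)),
    natDegree_pow, natDegree_X_sub_C, leadingCoeff_mul, leadingCoeff_C, leadingCoeff_pow,
    leadingCoeff_X_sub_C]
  simp

lemma natDegree_polyGamma (K k : ℕ) : (polyGamma K k).natDegree = k := by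
  have h := natDegree_C_sub_X_pow (eigval K - eigval 1) (k / 2)
  have hne : (C (eigval K - eigval 1) - X : ℝ[X]) ^ (k / 2) ≠ 0 := by
    rw [← leadingCoeff_ne_zero, h.2]; exact pow_ne_zero _ (by norm_num)
  rw [polyGamma, natDegree_mul (pow_ne_zero _ X_ne_zero) hne, natDegree_X_pow, h.1]
  omega

lemma coeff_polyGamma_self_ne_zero (K k : ℕ) : (polyGamma K k).coeff k ≠ 0 := by
  have h : (polyGamma K k).leadingCoeff = (-1) ^ (k / 2) := by
    rw [polyGamma, leadingCoeff_mul, (natDegree_C_sub_X_pow _ _).2, leadingCoeff_X_pow, one_mul]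
  rw [leadingCoeff, natDegree_polyGamma] at h
  rw [h]
  exact pow_ne_zero _ (by norm_num)

lemma quadCoef_eq {μ ν : ℝ → ℝ} (hμ : Continuous μ) (hν : Continuous ν) (K j : ℕ) :
    quadCoef μ ν K j = cosMat (cosCoef μ) 1 j * cosMat (cosCoef ν) j K := by
  rw [quadCoef, matElem_eq_cosMat hμ, matElem_eq_cosMat hν]

/-- By antisymmetry the two halves of the bracket are equal, and the factor `C (λ_K - λ_1) - 2 * X`
evaluates to twice `λ_j - (λ_1 + λ_K) / 2`; hence `1 / 4`. -/
lemma termA_eq_bracketTerm {μ : ℝ → ℝ} (hμ : Continuous μ) (K l j : ℕ) :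
    termA μ K (l + 1) j = 1 / 4 * bracketTerm (polyA K l) K (cosCoef μ) (cosCoef μ) j := by
  simp only [termA, bracketTerm, polyA, eval_mul, eval_sub, eval_C, eval_X, eval_pow, eval_ofNat,
    quadCoef_eq hμ hμ, Nat.add_sub_cancel]
  rw [show eigval K - eigval 1 - (eigval K - eigval j) = eigval j - eigval 1 by ring,
    show eigval K - eigval 1 - (eigval j - eigval 1) = eigval K - eigval j by ring]
  ring

lemma termGamma_eq_bracketTerm {μ₁ μ₂ : ℝ → ℝ} (hμ₁ : Continuous μ₁) (hμ₂ : Continuous μ₂)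
    (K k j : ℕ) :
    termGamma μ₁ μ₂ K k j = bracketTerm (polyGamma K k) K (cosCoef μ₁) (cosCoef μ₂) j := by
  simp only [termGamma, bracketTerm, polyGamma, eval_mul, eval_sub, eval_C, eval_X, eval_pow,
    quadCoef_eq hμ₁ hμ₂, quadCoef_eq hμ₂ hμ₁]
  rw [show eigval K - eigval 1 - (eigval K - eigval j) = eigval j - eigval 1 by ring,
    show eigval K - eigval 1 - (eigval j - eigval 1) = eigval K - eigval j by ring]
  ring

lemma hQuadA_of_hasSum {μ : ℝ → ℝ} (hμ : Continuous μ) {n K : ℕ}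
    (h : ∀ l, 2 * l + 1 ≤ n → HasSum (bracketTerm (polyA K l) K (cosCoef μ) (cosCoef μ)) 0) :
    HQuadA n K μ := by
  intro k hk hkn
  obtain ⟨l, rfl⟩ : ∃ l, k = l + 1 := ⟨k - 1, by omega⟩
  have hs : HasSum (fun j => termA μ K (l + 1) (j + 1)) 0 := by
    simp only [termA_eq_bracketTerm hμ]
    have := (hasSum_bracketTerm_succ (h l (by omega))).mul_left (1 / 4)
    rwa [mul_zero] at this
  exact ⟨hs.summable, by rw [coefA, hs.tsum_eq, mul_zero]⟩

lemma hReg_of_realizes {p : ℕ} (m : ℕ) {μ : ℝ → ℝ} (hμ : ContDiff ℝ ∞ μ)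
    (hb : ∀ i < p, iteratedDeriv (2 * i + 1) μ 0 = 0 ∧ iteratedDeriv (2 * i + 1) μ 1 = 0) :
    MemH (2 * (p + m) + 3) μ ∧ ∀ k < p, DerivVanishesAtBoundary (2 * k + 1) μ :=
  ⟨memH_of_smooth hμ _, fun k hk => ⟨iteratedDeriv (2 * k + 1) μ,
    (continuous_iteratedDeriv_of_smooth hμ _).continuousOn, isWeakDeriv_iteratedDeriv hμ _,
    (hb k hk).1, (hb k hk).2⟩⟩

/-! ### Lower bound on the linear coefficients -/

lemma one_div_pow_succ_le_cosMat {m : ℕ → ℝ} {s N : ℕ} (hm : ∀ k ≥ N, m k = 1 / (k : ℝ) ^ s)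
    (hs : s ≠ 0) {j : ℕ} (hj : N + 2 ≤ j) : 1 / (j : ℝ) ^ (s + 1) ≤ cosMat m 1 j := by
  obtain ⟨r, rfl⟩ : ∃ r, s = r + 1 := ⟨s - 1, by omega⟩
  rw [cosMat, hm _ (by omega), hm _ (by omega), show 1 - j + (j - 1) = j - 1 by omega,
    Nat.cast_pred (by omega)]
  push_cast
  have hj' : (2 : ℝ) ≤ j := by exact_mod_cast (show 2 ≤ j by omega)
  have hx : (0 : ℝ) < j - 1 := by linarith
  have hxr : (0 : ℝ) < ((j : ℝ) - 1) ^ r := by positivity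
  calc 1 / (j : ℝ) ^ (r + 1 + 1)
      ≤ 2 / ((1 + j) * ((j : ℝ) - 1) ^ (r + 1)) := by
        rw [div_le_div_iff₀ (by positivity) (by positivity)]
        have : ((j : ℝ) - 1) ^ (r + 1) ≤ (j : ℝ) ^ (r + 1) := by gcongr; linarith
        calc 1 * ((1 + j) * ((j : ℝ) - 1) ^ (r + 1)) ≤ 1 * ((2 * j) * (j : ℝ) ^ (r + 1)) := by
              gcongr; linarith
          _ = 2 * (j : ℝ) ^ (r + 1 + 1) := by ring
    _ ≤ 1 / ((j : ℝ) - 1) ^ (r + 1) - 1 / (1 + j) ^ (r + 1) := by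
        -- Weakening all but one factor `1 + j` to `j - 1` leaves `(j - 1) ^ (-r)` times the
        -- difference of `1 / (j - 1)` and `1 / (j + 1)`, which is explicit.
        have h1 : (1 : ℝ) / (1 + j) ^ (r + 1) ≤ 1 / ((1 + j) * ((j : ℝ) - 1) ^ r) := by
          rw [pow_succ']
          gcongr
          linarith
        have h2 : 1 / ((j : ℝ) - 1) ^ (r + 1) - 1 / ((1 + j) * ((j : ℝ) - 1) ^ r)
            = 2 / ((1 + j) * ((j : ℝ) - 1) ^ (r + 1)) := by
          rw [pow_succ]; field_simp; ring
        linarith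

lemma exists_pos_lower_bound {P : ℕ → Prop} {g : ℕ → ℝ} {J : ℕ} (h1 : ∀ j ≥ J, 1 ≤ g j)
    (h0 : ∀ j, P j → 0 < g j) : ∃ C : ℝ, 0 < C ∧ ∀ j, P j → C ≤ g j := by
  have hfin : ∀ J, ∃ C : ℝ, 0 < C ∧ ∀ j < J, P j → C ≤ g j := by
    intro J
    induction J with
    | zero => exact ⟨1, one_pos, by simp⟩
    | succ J ih =>
      obtain ⟨C, hC, hCj⟩ := ih
      by_cases hP : P J
      · refine ⟨min C (g J), lt_min hC (h0 J hP), fun j hj hjP => ?_⟩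
        rcases Nat.lt_succ_iff_lt_or_eq.1 hj with hj | rfl
        · exact (min_le_left _ _).trans (hCj j hj hjP)
        · exact min_le_right _ _
      · refine ⟨C, hC, fun j hj hjP => ?_⟩
        rcases Nat.lt_succ_iff_lt_or_eq.1 hj with hj | rfl
        · exact hCj j hj hjP
        · exact absurd hjP hP
  obtain ⟨C, hC, hCj⟩ := hfin J
  refine ⟨min C 1, lt_min hC one_pos, fun j hjP => ?_⟩
  rcases lt_or_ge j J with hj | hj
  · exact (min_le_left _ _).trans (hCj j hj hjP)
  · exact (min_le_right _ _).trans (h1 j hj)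

/-- The first moment alone carries the bound: its tail decays exactly fast enough, and the finitely
many other indices only need nonvanishing. -/
lemma hLin2_of_cosMat {p K N : ℕ} {μ₁ μ₂ : ℝ → ℝ} (hμ₁ : Continuous μ₁)
    (hm : ∀ k ≥ N, cosCoef μ₁ k = 1 / (k : ℝ) ^ (2 * p + 2))
    (hne : ∀ j, 1 ≤ j → j ≠ K → cosMat (cosCoef μ₁) 1 j ≠ 0) : HLin2 p K μ₁ μ₂ := by
  obtain ⟨C, hC, hCj⟩ := exists_pos_lower_bound (P := fun j => 1 ≤ j ∧ j ≠ K)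
    (g := fun j => |cosMat (cosCoef μ₁) 1 j| * (j : ℝ) ^ (2 * p + 3)) (J := N + 2)
    (fun j hj => by
      have hj0 : (0 : ℝ) < j := by exact_mod_cast (show 0 < j by omega)
      rw [← div_le_iff₀ (by positivity)]
      exact (one_div_pow_succ_le_cosMat hm (by omega) hj).trans (le_abs_self _))
    (fun j hj => by
      have hj0 : (0 : ℝ) < j := by exact_mod_cast hj.1
      exact mul_pos (abs_pos.2 (hne j hj.1 hj.2)) (by positivity))
  refine ⟨C, hC, fun j hj hjK => ?_⟩
  have hj0 : (0 : ℝ) < j := by exact_mod_cast hj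
  calc C / (j : ℝ) ^ (2 * p + 3) ≤ |matElem μ₁ 1 j| := by
        rw [div_le_iff₀ (by positivity), matElem_eq_cosMat hμ₁]
        exact hCj j ⟨hj, hjK⟩
    _ = Real.sqrt (matElem μ₁ 1 j ^ 2) := (Real.sqrt_sq_eq_abs _).symm
    _ ≤ _ := Real.sqrt_le_sqrt (le_add_of_nonneg_right (sq_nonneg _))

end BilinearSchrodinger

theorem theoremA4 (n K p m : ℕ) (hn : 1 ≤ n) (hK : 2 ≤ K) (hnp : n / 2 ≤ p) :
    ∃ μ₁ μ₂ : ℝ → ℝ,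
      BilinearSchrodinger.HReg p m μ₁ μ₂ ∧
      BilinearSchrodinger.HLin1 K μ₁ μ₂ ∧
      BilinearSchrodinger.HLin2 p K μ₁ μ₂ ∧
      BilinearSchrodinger.HQuadA n K μ₁ ∧
      BilinearSchrodinger.HQuadA n K μ₂ ∧
      BilinearSchrodinger.HQuad3 n K μ₁ μ₂ ∧
      BilinearSchrodinger.HQuad4 n K μ₁ μ₂ := by
  open BilinearSchrodinger Polynomial in
  have hns : n < 2 * p + 2 := by omega
  obtain ⟨m₁, N, hm₁, hK₁, hne₁, hA₁⟩ := exists_first_sequence hK hns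
  -- The prescribed form is the coefficient of `X ^ n`, which kills constants because `n ≥ 1`.
  obtain ⟨a, ha, haL⟩ := exists_finsupp_hasSum_bracketTerm hK hns (M := 2 * K + 2) (by omega) hm₁
    (K + 2) (lcoeff ℝ n) (by rw [lcoeff_apply, coeff_one, if_neg (by omega)])
  obtain ⟨μ₁, hμ₁, rfl, hb₁⟩ := isCosRealizable_of_eventually hm₁
  -- A finitely supported sequence has tail `0 / k ^ (2p + 2)`, hence `c = 0`.
  obtain ⟨μ₂, hμ₂, hμ₂a, hb₂⟩ := isCosRealizable_of_eventually (p := p) (m := a) (c := 0)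
    (N := a.support.sup id + 1) fun k hk => by
      rw [zero_div]
      by_contra h
      have : k ≤ a.support.sup id := Finset.le_sup (f := id) (Finsupp.mem_support_iff.2 h)
      omega
  have hγ : ∀ k ≤ n, HasSum (fun j => termGamma μ₁ μ₂ K k (j + 1)) ((polyGamma K k).coeff n) := by
    intro k hk
    simp only [termGamma_eq_bracketTerm hμ₁.continuous hμ₂.continuous, hμ₂a]
    exact hasSum_bracketTerm_succ (haL _ ((natDegree_polyGamma K k).trans_le hk))
  refine ⟨μ₁, μ₂, ⟨hReg_of_realizes m hμ₁ hb₁, hReg_of_realizes m hμ₂ hb₂⟩, ⟨?_, ?_⟩,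
    hLin2_of_cosMat hμ₁.continuous hm₁ hne₁, ?_, ?_, fun k _ hk => ?_, ?_⟩
  · rw [matElem_eq_cosMat hμ₁.continuous, hK₁]
  · rw [matElem_eq_cosMat hμ₂.continuous, hμ₂a]
    exact cosMat_one_eq_zero_of_support fun e he => (ha e he).2
  · exact hQuadA_of_hasSum hμ₁.continuous fun l hl =>
      hA₁ _ ((natDegree_polyA_le K l).trans hl) (polyA_antisymm K l)
  · refine hQuadA_of_hasSum hμ₂.continuous fun l _ => ?_
    have h0 : bracketTerm (polyA K l) K (cosCoef μ₂) (cosCoef μ₂) = fun _ => 0 := by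
      ext j
      rw [bracketTerm, hμ₂a, cosMat_mul_cosMat_eq_zero hK (fun e he => (ha e he).1)
        (fun e he => (ha e he).1), mul_zero, mul_zero, sub_zero]
    rw [h0]
    exact hasSum_zero
  · have h := hγ k (by omega)
    rw [coeff_eq_zero_of_natDegree_lt (by rw [natDegree_polyGamma]; omega)] at h
    exact ⟨h.summable, h.tsum_eq⟩
  · have h := hγ n le_rfl
    exact ⟨h.summable, by rw [coefGamma, h.tsum_eq]; exact coeff_polyGamma_self_ne_zero K n⟩
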